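/- Equip $\mathbb{C}^6=\mathbb{C}^2\otimes\mathbb{C}^3$ with its standard inner product. A product basis is an orthonormal basis of $\mathbb{C}^2\otimes\mathbb{C}^3$ all of whose six elements are product vectors $a\otimes A$ with $a\in\mathbb{C}^2$, $A\in\mathbb{C}^3$. Two orthonormal bases $\{\phi_k\}_{k=1}^6$ and $\{\psi_j\}_{j=1}^6$ are mutually unbiased if $|\langle\psi_j,\phi_k\rangle|^2=1/6$ for all $j,k$, and a vector $\psi$ is mutually unbiased to the basis $\{\phi_k\}_{k=1}^6$ if $|\langle\phi_k,\psi\rangle|^2=1/6$ for all $k$. **Theorem.** Let $\mathcal{B}_1,\mathcal{B}_2,\mathcal{B}_3$ be three pairwise mutually unbiased product bases of $\mathbb{C}^2\otimes\mathbb{C}^3$. Then there is no vector $\psi\in\mathbb{C}^2\otimes\mathbb{C}^3$ that is mutually unbiased to all three of $\mathcal{B}_1$, $\mathcal{B}_2$ and $\mathcal{B}_3$. -/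

import Mathlib

open scoped TensorProduct

/-- The Hilbert space `ℂ² ⊗ ℂ³` (of dimension six), with Mathlib's inner product on the tensor
product, for which `⟪a ⊗ A, b ⊗ B⟫ = ⟪a, b⟫ * ⟪A, B⟫`. -/
abbrev QubitQutrit : Type :=
  EuclideanSpace ℂ (Fin 2) ⊗[ℂ] EuclideanSpace ℂ (Fin 3)

/-- A vector `ψ` is mutually unbiased to the orthonormal basis `B` of a `d`-dimensional space:
`|⟪B k, ψ⟫|² = 1 / d` for all `k`. (By Parseval's identity such a `ψ` is a unit vector.) -/
def VectorUnbiased {ι E : Type*} [Fintype ι] [NormedAddCommGroup E] [InnerProductSpace ℂ E]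
    (B : OrthonormalBasis ι ℂ E) (ψ : E) : Prop :=
  ∀ k : ι, ‖inner ℂ (B k) ψ‖ ^ 2 = 1 / (Fintype.card ι : ℝ)

/-- Two orthonormal bases of a `d`-dimensional space are mutually unbiased:
`|⟪B' j, B k⟫|² = 1 / d` for all `j`, `k`. -/
def MutuallyUnbiased {ι E : Type*} [Fintype ι] [NormedAddCommGroup E] [InnerProductSpace ℂ E]
    (B B' : OrthonormalBasis ι ℂ E) : Prop :=
  ∀ j k : ι, ‖inner ℂ (B' j) (B k)‖ ^ 2 = 1 / (Fintype.card ι : ℝ)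

/-- A product basis of `ℂ² ⊗ ℂ³`: each of the six orthonormal basis vectors is a product vector.
It need not be the product of a basis of `ℂ²` with a basis of `ℂ³`. -/
def IsProductBasis (B : OrthonormalBasis (Fin 6) ℂ QubitQutrit) : Prop :=
  ∀ k : Fin 6, ∃ (a : EuclideanSpace ℂ (Fin 2)) (A : EuclideanSpace ℂ (Fin 3)), B k = a ⊗ₜ[ℂ] A

/-!
Counting with partial traces shows that product vectors taken from different bases of a mutually
unbiased triple are unbiased in each factor separately
(`norm_inner_left_factor_of_unbiased`). In `ℂ²` a vector unbiased to two unbiased vectors is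
determined up to phase and orthogonal complement, so the first factors of each basis run through a
single orthonormal basis `e`, and over each `e j` there is an orthonormal basis `D j` of `ℂ³`
(`exists_isFibred_of_triple`).

In `ℂ³`, the vectors unbiased to two mutually unbiased bases form two orthogonal triples that are
unbiased to one another (`exists_type`), so any two of them have squared overlap `0`, `1` or `1 / 3`.
As a consequence, `D 0` and `D 1` consist of the same rays for at least two of the three product
bases (`sameRays_or_sameRays`).

Suppose that `ψ` is unbiased to the three product bases. Its contractions `(⟨a| ⊗ 1) ψ` have square
norm `1 / 2` for `a` in each of the three bases of `ℂ²`, which are mutually unbiased. Therefore `ψ` is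
maximally entangled: contraction preserves overlaps up to the factor `1 / 2`
(`inner_partialInner_partialInner`), and its range is the orthogonal complement of a unit vector `χ`.
For two product bases with equal fibres, `χ` is unbiased to both fibres. A vector orthogonal to `χ`
that is unbiased to one fibre is then unbiased to the other (`VectorUnbiased.of_orthogonal`). The
normalized contractions of `ψ` with one first factor from each of the two bases are therefore
unbiased to the same two bases of `ℂ³`, but have squared overlap `1 / 2`: a contradiction.
-/

open Complex ComplexConjugate

/-! ### Triples of complex numbers of equal modulus -/

theorem re_of_primitive {η : ℂ} (h : η ^ 2 + η + 1 = 0) : η.re = -1 / 2 ∧ η.im ^ 2 = 3 / 4 := by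
  have h1 := congrArg re h
  have h2 := congrArg im h
  simp [pow_two] at h1 h2
  have him : η.im ≠ 0 := by
    intro h0
    rw [h0] at h1
    nlinarith [sq_nonneg (η.re + 1 / 2)]
  have hre : η.re = -1 / 2 := by
    have : η.im * (2 * η.re + 1) = 0 := by linarith
    rcases mul_eq_zero.1 this with h | h
    · exact absurd h him
    · linarith
  refine ⟨hre, ?_⟩
  rw [hre] at h1
  nlinarith

theorem im_ne_zero_of_primitive {η : ℂ} (h : η ^ 2 + η + 1 = 0) : η.im ≠ 0 := by
  intro h0
  have := (re_of_primitive h).2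
  rw [h0] at this
  norm_num at this

theorem conj_of_primitive {η : ℂ} (h : η ^ 2 + η + 1 = 0) : conj η = η ^ 2 := by
  have h1 := (re_of_primitive h).1
  rw [show η ^ 2 = -1 - η by linear_combination h]
  apply Complex.ext
  · simp [h1]; norm_num
  · simp

theorem pow_three_of_primitive {η : ℂ} (h : η ^ 2 + η + 1 = 0) : η ^ 3 = 1 := by
  linear_combination (η - 1) * h

theorem primitive_eq_or {η θ : ℂ} (h : η ^ 2 + η + 1 = 0) (h' : θ ^ 2 + θ + 1 = 0) :
    θ = η ∨ θ = η ^ 2 := by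
  have : (θ - η) * (θ - η ^ 2) = 0 := by
    linear_combination h' + (η - 1 - θ) * h
  rcases mul_eq_zero.1 this with h | h
  · exact Or.inl (sub_eq_zero.1 h)
  · exact Or.inr (sub_eq_zero.1 h)

/-- Three complex numbers of equal modulus with sum zero form an equilateral triangle about the
origin. -/
theorem exists_primitive_of_add_eq_zero {a b c : ℂ} (ha : a ≠ 0) (hb : normSq b = normSq a)
    (hc : normSq c = normSq a) (h : a + b + c = 0) :
    ∃ η : ℂ, η ^ 2 + η + 1 = 0 ∧ b = η * a ∧ c = η ^ 2 * a := by
  have hη : (b / a) ^ 2 + b / a + 1 = 0 := by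
    have hna : normSq a ≠ 0 := (map_ne_zero normSq).2 ha
    have h1 : normSq (b / a) = 1 := by rw [map_div₀, hb, div_self hna]
    have h2 : normSq (1 + b / a) = 1 := by
      have : 1 + b / a = -(c / a) := by
        field_simp
        linear_combination h
      rw [this, normSq_neg, map_div₀, hc, div_self hna]
    generalize b / a = z at h1 h2
    rw [normSq_apply] at h1 h2
    simp at h2
    have hre : z.re = -1 / 2 := by linarith
    apply Complex.ext
    · simp [pow_two, hre] at *; linarith
    · simp [pow_two, hre]; ring
  refine ⟨b / a, hη, by field_simp, ?_⟩
  have : (b / a) * a = b := by field_simp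
  linear_combination h - a * hη + this

/-- The cyclic autocorrelation `d̄₀ d₁ + d̄₁ d₂ + d̄₂ d₀`. With coordinates taken in a basis `Z` and
`dᵢ = x̄ᵢ uᵢ`, its real part decides whether `|⟪x, u⟫|² = 1 / 3` (`normSq_sum_eq_cyc`). -/
def cyc (d : Fin 3 → ℂ) : ℂ := conj (d 0) * d 1 + conj (d 1) * d 2 + conj (d 2) * d 0

theorem normSq_sum_eq_cyc (d : Fin 3 → ℂ) :
    normSq (∑ i, d i) = ∑ i, normSq (d i) + 2 * (cyc d).re := by
  simp [Fin.sum_univ_three, cyc, normSq_apply]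
  ring

/-- Multiplying a triple entrywise by unimodular numbers with sum zero (here rescaled to modulus
`1 / 3`, whence the factor `3`) multiplies its cyclic autocorrelation by a primitive cube root of
unity. -/
theorem exists_cyc_twist {g : Fin 3 → ℂ} (hg : ∀ i, normSq (g i) = 1 / 9) (h0 : ∑ i, g i = 0) :
    ∃ η : ℂ, η ^ 2 + η + 1 = 0 ∧ ∀ d : Fin 3 → ℂ,
      cyc (fun i => 3 * (g i * d i)) = η * cyc d := by
  have hg0 : g 0 ≠ 0 := by
    intro h
    have := hg 0
    rw [h] at this
    norm_num at this
  obtain ⟨η, hη, h1, h2⟩ := exists_primitive_of_add_eq_zero (b := g 1) (c := g 2) hg0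
    (by rw [hg, hg]) (by rw [hg, hg])
    (by rw [← h0, Fin.sum_univ_three])
  refine ⟨η, hη, fun d => ?_⟩
  have hn : conj (g 0) * g 0 = 1 / 9 := by
    rw [← normSq_eq_conj_mul_self, hg]; norm_num
  have h3 := pow_three_of_primitive hη
  simp only [cyc, h1, h2, map_mul, map_pow, conj_of_primitive hη, map_ofNat]
  linear_combination 9 * (η * conj (d 0) * d 1 + η * conj (d 1) * d 2 + η * conj (d 2) * d 0) * hn +
    9 * conj (g 0) * g 0 * (η * (conj (d 1) * d 2) + η * conj (d 2) * d 0) * h3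

/-- Being unbiased to `x` and to `y ⊥ x` kills the real parts of both `cyc d` and `η * cyc d`, where
`η` is a primitive cube root of unity; so the whole of `cyc d` vanishes. -/
theorem cyc_eq_zero_of_unbiased {x y u : Fin 3 → ℂ} (hx : ∀ i, normSq (x i) = 1 / 3)
    (hy : ∀ i, normSq (y i) = 1 / 3) (hu : ∀ i, normSq (u i) = 1 / 3)
    (hxy : ∑ i, conj (x i) * y i = 0) (hxu : normSq (∑ i, conj (x i) * u i) = 1 / 3)
    (hyu : normSq (∑ i, conj (y i) * u i) = 1 / 3) :
    cyc (fun i => conj (x i) * u i) = 0 := by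
  obtain ⟨η, hη, H⟩ := exists_cyc_twist (g := fun i => x i * conj (y i))
    (fun i => by rw [map_mul, normSq_conj, hx, hy]; norm_num)
    (by rw [← map_zero conj, ← hxy, map_sum]; simp)
  have H' := H (fun i => conj (x i) * u i)
  have he : (fun i => 3 * (x i * conj (y i) * (conj (x i) * u i))) = fun i => conj (y i) * u i := by
    funext i
    have : conj (x i) * x i = 1 / 3 := by rw [← normSq_eq_conj_mul_self, hx]; norm_num
    linear_combination 3 * conj (y i) * u i * this
  rw [he] at H'
  rw [normSq_sum_eq_cyc] at hxu hyu
  simp only [map_mul, normSq_conj, hx, hy, hu, Fin.sum_univ_three] at hxu hyu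
  rw [H'] at hyu
  have h1 : (cyc fun i => conj (x i) * u i).re = 0 := by linarith
  rw [mul_re, h1] at hyu
  have h2 : η.im * (cyc fun i => conj (x i) * u i).im = 0 := by linarith
  rcases mul_eq_zero.1 h2 with h | h
  · exact absurd h (im_ne_zero_of_primitive hη)
  · exact Complex.ext h1 h

/-- The vanishing of the autocorrelation passes from `w` to every unbiased `v ⊥ w`, since it is
only multiplied by a cube root of unity; hence `v` is unbiased to `x` as well. -/
theorem unbiased_of_cyc_eq_zero {x w v : Fin 3 → ℂ} (hx : ∀ i, normSq (x i) = 1 / 3)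
    (hw : ∀ i, normSq (w i) = 1 / 3) (hv : ∀ i, normSq (v i) = 1 / 3)
    (hwv : ∑ i, conj (w i) * v i = 0) (hxw : cyc (fun i => conj (x i) * w i) = 0) :
    normSq (∑ i, conj (x i) * v i) = 1 / 3 := by
  obtain ⟨η, -, H⟩ := exists_cyc_twist (g := fun i => conj (w i) * v i)
    (fun i => by rw [map_mul, normSq_conj, hw, hv]; norm_num) hwv
  have H' := H (fun i => conj (x i) * w i)
  have he : (fun i => 3 * (conj (w i) * v i * (conj (x i) * w i))) = fun i => conj (x i) * v i := by
    funext i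
    have : conj (w i) * w i = 1 / 3 := by rw [← normSq_eq_conj_mul_self, hw]; norm_num
    linear_combination 3 * conj (x i) * v i * this
  rw [he, hxw, mul_zero] at H'
  rw [normSq_sum_eq_cyc, H']
  simp [hx, hv]

/-- A triple of equal moduli with vanishing autocorrelation is a multiple of `(1, s, η s²)` with
`s` a cube root of unity and `η` a primitive one: six rays, three for each of the two `η`. -/
theorem exists_form_of_cyc_eq_zero {d : Fin 3 → ℂ} (hd : ∀ i, normSq (d i) = 1 / 9)
    (h : cyc d = 0) :
    ∃ η s : ℂ, η ^ 2 + η + 1 = 0 ∧ s ^ 3 = 1 ∧ d 1 = s * d 0 ∧ d 2 = η * s ^ 2 * d 0 := by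
  have hn : ∀ i, conj (d i) * d i = 1 / 9 := fun i => by
    rw [← normSq_eq_conj_mul_self, hd]; norm_num
  have hne : ∀ i, d i ≠ 0 := fun i h => by
    have := hd i
    rw [h] at this
    norm_num at this
  obtain ⟨η, hη, h1, h2⟩ := exists_primitive_of_add_eq_zero
    (a := conj (d 0) * d 1) (b := conj (d 1) * d 2) (c := conj (d 2) * d 0)
    (mul_ne_zero ((map_ne_zero _).2 (hne 0)) (hne 1)) (by simp [hd]) (by simp [hd]) h
  have hs : d 1 = d 1 / d 0 * d 0 := by field_simp [hne 0]
  generalize d 1 / d 0 = s at hs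
  have hd2 : d 2 = η * s ^ 2 * d 0 := by
    linear_combination -9 * d 2 * hn 1 + 9 * d 1 * h1 + 9 * η * conj (d 0) * (d 1 + s * d 0) * hs
      + 9 * η * s ^ 2 * d 0 * hn 0
  refine ⟨η, s, hη, ?_, hs, hd2⟩
  have h3 := pow_three_of_primitive hη
  have : d 0 * (s ^ 3 - 1) = 0 := by
    linear_combination 9 * d 0 * hn 2 - 9 * d 2 * h2 - 9 * η ^ 2 * conj (d 0) * d 2 * hs
      - 9 * η ^ 2 * conj (d 0) * s * d 0 * hd2 - 9 * s ^ 3 * d 0 * η ^ 3 * hn 0 - s ^ 3 * d 0 * h3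
  rcases mul_eq_zero.1 this with h | h
  · exact absurd h (hne 0)
  · exact sub_eq_zero.1 h

theorem eq_one_or_primitive {ζ : ℂ} (h : ζ ^ 3 = 1) : ζ = 1 ∨ ζ ^ 2 + ζ + 1 = 0 := by
  have : (ζ - 1) * (ζ ^ 2 + ζ + 1) = 0 := by linear_combination h
  rcases mul_eq_zero.1 this with h | h
  · exact Or.inl (sub_eq_zero.1 h)
  · exact Or.inr h

theorem normSq_one_add_add_sq {ζ : ℂ} (h : ζ ^ 3 = 1) :
    normSq (1 + ζ + ζ ^ 2) = 0 ∨ normSq (1 + ζ + ζ ^ 2) = 9 := by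
  rcases eq_one_or_primitive h with rfl | h
  · right; norm_num [normSq_apply]
  · left; rw [show 1 + ζ + ζ ^ 2 = 0 by linear_combination h, map_zero]

theorem normSq_one_add_add_mul_sq {ζ θ : ℂ} (h : ζ ^ 3 = 1) (hθ : θ ^ 2 + θ + 1 = 0) :
    normSq (1 + ζ + θ * ζ ^ 2) = 3 := by
  obtain ⟨h1, h2⟩ := re_of_primitive hθ
  have h3 := pow_three_of_primitive hθ
  have key : normSq (2 + θ) = 3 := by
    simp [normSq_apply, h1]; nlinarith
  rcases eq_one_or_primitive h with rfl | h
  · rw [← key]; ring_nf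
  · rcases primitive_eq_or hθ h with rfl | rfl
    · rw [← key]
      congr 1
      linear_combination h3
    · rw [show 1 + θ ^ 2 + θ * (θ ^ 2) ^ 2 = -(1 + 2 * θ) by
        linear_combination 2 * hθ + θ ^ 2 * h3]
      simp [normSq_apply, h1]; nlinarith

/-- The overlaps among the six rays of `exists_form_of_cyc_eq_zero`: those with the same `η` form
an orthogonal triple, and the two triples are mutually unbiased. -/
theorem normSq_inner_of_form {d e : Fin 3 → ℂ} {η θ s t : ℂ} (hd : ∀ i, normSq (d i) = 1 / 9)
    (he : ∀ i, normSq (e i) = 1 / 9) (hη : η ^ 2 + η + 1 = 0) (hθ : θ ^ 2 + θ + 1 = 0)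
    (hs : s ^ 3 = 1) (ht : t ^ 3 = 1) (d1 : d 1 = s * d 0) (d2 : d 2 = η * s ^ 2 * d 0)
    (e1 : e 1 = t * e 0) (e2 : e 2 = θ * t ^ 2 * e 0) :
    (θ = η → normSq (∑ i, conj (d i) * e i) = 0 ∨ normSq (∑ i, conj (d i) * e i) = 1 / 9) ∧
    (θ ≠ η → normSq (∑ i, conj (d i) * e i) = 1 / 27) := by
  have hsum : normSq (∑ i, conj (d i) * e i) =
      1 / 81 * normSq (1 + conj s * t + conj η * θ * (conj s * t) ^ 2) := by
    rw [show ∑ i, conj (d i) * e i =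
      conj (d 0) * e 0 * (1 + conj s * t + conj η * θ * (conj s * t) ^ 2) by
        rw [Fin.sum_univ_three, d1, d2, e1, e2]
        simp only [map_mul, map_pow]
        ring, map_mul, map_mul, normSq_conj, hd, he]
    norm_num
  have hζ : (conj s * t) ^ 3 = 1 := by rw [mul_pow, ← map_pow, hs, ht]; simp
  have h3 := pow_three_of_primitive hη
  rw [hsum]
  constructor
  · rintro rfl
    rw [conj_of_primitive hη, show θ ^ 2 * θ = 1 by linear_combination h3, one_mul]
    rcases normSq_one_add_add_sq hζ with h | h <;> rw [h] <;> norm_num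
  · intro hne
    rcases primitive_eq_or hη hθ with h | rfl
    · exact absurd h hne
    · rw [conj_of_primitive hη, show η ^ 2 * η ^ 2 = η by linear_combination η * h3,
        normSq_one_add_add_mul_sq hζ hη]
      norm_num

/-! ### Vectors unbiased to a pair of mutually unbiased bases of a three-dimensional space -/

section Dim3
variable {E : Type*} [NormedAddCommGroup E] [InnerProductSpace ℂ E]

theorem VectorUnbiased.normSq_eq {Z : OrthonormalBasis (Fin 3) ℂ E} {u : E}
    (h : VectorUnbiased Z u) (i : Fin 3) : normSq (inner ℂ (Z i) u) = 1 / 3 := by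
  rw [normSq_eq_norm_sq, h i]; simp

theorem sum_conj_coord_mul (Z : OrthonormalBasis (Fin 3) ℂ E) (u v : E) :
    ∑ i, conj (inner ℂ (Z i) u) * inner ℂ (Z i) v = inner ℂ u v := by
  rw [← Z.sum_inner_mul_inner u v]
  simp only [inner_conj_symm]

theorem cyc_coord_eq_zero {Z X : OrthonormalBasis (Fin 3) ℂ E} (hZX : MutuallyUnbiased X Z) {u : E}
    (hZ : VectorUnbiased Z u) (hX : VectorUnbiased X u) (k : Fin 3) :
    cyc (fun i => conj (inner ℂ (Z i) (X k)) * inner ℂ (Z i) u) = 0 := by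
  have hx : ∀ k, VectorUnbiased Z (X k) := fun k i => hZX i k
  refine cyc_eq_zero_of_unbiased (y := fun i => inner ℂ (Z i) (X (k + 1))) (hx k).normSq_eq
    (hx _).normSq_eq hZ.normSq_eq ?_ ?_ ?_
  · rw [sum_conj_coord_mul]
    exact X.orthonormal.2 (by fin_cases k <;> decide)
  · rw [sum_conj_coord_mul]; exact hX.normSq_eq k
  · rw [sum_conj_coord_mul]; exact hX.normSq_eq _

/-- If `w` is unbiased to the mutually unbiased bases `Z` and `X`, then any vector orthogonal to `w`
and unbiased to `Z` is automatically unbiased to `X`. -/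
theorem VectorUnbiased.of_orthogonal {Z X : OrthonormalBasis (Fin 3) ℂ E}
    (hZX : MutuallyUnbiased X Z) {w v : E} (hwZ : VectorUnbiased Z w) (hwX : VectorUnbiased X w)
    (hwv : inner ℂ w v = 0) (hvZ : VectorUnbiased Z v) : VectorUnbiased X v := by
  intro k
  have h := unbiased_of_cyc_eq_zero (x := fun i => inner ℂ (Z i) (X k))
    (fun i => VectorUnbiased.normSq_eq (fun j => hZX j k) i) hwZ.normSq_eq hvZ.normSq_eq
    (by rw [sum_conj_coord_mul, hwv]) (cyc_coord_eq_zero hZX hwZ hwX k)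
  rw [sum_conj_coord_mul, normSq_eq_norm_sq] at h
  simpa using h

/-- For mutually unbiased `Z` and `X`, the vectors unbiased to both fall into two types, labelled by
the primitive cube roots of unity: vectors of the same type are parallel or orthogonal, and vectors
of different types are unbiased. (The value `τ u` is meaningful only for such `u`.) -/
theorem exists_type {Z X : OrthonormalBasis (Fin 3) ℂ E} (hZX : MutuallyUnbiased X Z) :
    ∃ τ : E → ℂ, ∀ u, VectorUnbiased Z u → VectorUnbiased X u → τ u ^ 2 + τ u + 1 = 0 ∧
      ∀ v, VectorUnbiased Z v → VectorUnbiased X v →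
        (τ v = τ u → ‖inner ℂ u v‖ ^ 2 = 0 ∨ ‖inner ℂ u v‖ ^ 2 = 1) ∧
        (τ v ≠ τ u → ‖inner ℂ u v‖ ^ 2 = 1 / 3) := by
  have hx : ∀ i, normSq (inner ℂ (Z i) (X 0)) = 1 / 3 :=
    fun i => VectorUnbiased.normSq_eq (fun j => hZX j 0) i
  have hd : ∀ u, VectorUnbiased Z u → ∀ i,
      normSq (conj (inner ℂ (Z i) (X 0)) * inner ℂ (Z i) u) = 1 / 9 := fun u hu i => by
    rw [map_mul, normSq_conj, hx, hu.normSq_eq]; norm_num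
  have H : ∀ u, ∃ η : ℂ, VectorUnbiased Z u → VectorUnbiased X u →
      ∃ s : ℂ, η ^ 2 + η + 1 = 0 ∧ s ^ 3 = 1 ∧
        conj (inner ℂ (Z 1) (X 0)) * inner ℂ (Z 1) u =
          s * (conj (inner ℂ (Z 0) (X 0)) * inner ℂ (Z 0) u) ∧
        conj (inner ℂ (Z 2) (X 0)) * inner ℂ (Z 2) u =
          η * s ^ 2 * (conj (inner ℂ (Z 0) (X 0)) * inner ℂ (Z 0) u) := by
    intro u
    by_cases h : VectorUnbiased Z u ∧ VectorUnbiased X u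
    · obtain ⟨η, s, h'⟩ := exists_form_of_cyc_eq_zero (hd u h.1) (cyc_coord_eq_zero hZX h.1 h.2 0)
      exact ⟨η, fun _ _ => ⟨s, h'⟩⟩
    · exact ⟨0, fun h1 h2 => absurd ⟨h1, h2⟩ h⟩
  choose τ hτ using H
  refine ⟨τ, fun u huZ huX => ?_⟩
  obtain ⟨s, hη, hs, u1, u2⟩ := hτ u huZ huX
  refine ⟨hη, fun v hvZ hvX => ?_⟩
  obtain ⟨t, hθ, ht, v1, v2⟩ := hτ v hvZ hvX
  have key := normSq_inner_of_form (hd u huZ) (hd v hvZ) hη hθ hs ht u1 u2 v1 v2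
  have hsum : normSq (∑ i, conj (conj (inner ℂ (Z i) (X 0)) * inner ℂ (Z i) u) *
      (conj (inner ℂ (Z i) (X 0)) * inner ℂ (Z i) v)) = 1 / 9 * ‖inner ℂ u v‖ ^ 2 := by
    have : ∀ i, conj (conj (inner ℂ (Z i) (X 0)) * inner ℂ (Z i) u) *
      (conj (inner ℂ (Z i) (X 0)) * inner ℂ (Z i) v) =
        1 / 3 * (conj (inner ℂ (Z i) u) * inner ℂ (Z i) v) := fun i => by
      have : inner ℂ (Z i) (X 0) * conj (inner ℂ (Z i) (X 0)) = 1 / 3 := by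
        rw [mul_conj, hx]; norm_num
      rw [map_mul, conj_conj, ← this]
      ring
    simp only [this]
    rw [← Finset.mul_sum, sum_conj_coord_mul, map_mul, normSq_eq_norm_sq (inner ℂ u v)]
    norm_num
  rw [hsum] at key
  refine ⟨fun h => ?_, fun h => ?_⟩
  · rcases key.1 h with h | h
    · left; linarith
    · right; linarith
  · linarith [key.2 h]

theorem overlap_of_unbiased {Z X : OrthonormalBasis (Fin 3) ℂ E} (hZX : MutuallyUnbiased X Z)
    {u v : E} (huZ : VectorUnbiased Z u) (huX : VectorUnbiased X u) (hvZ : VectorUnbiased Z v)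
    (hvX : VectorUnbiased X v) :
    ‖inner ℂ u v‖ ^ 2 = 0 ∨ ‖inner ℂ u v‖ ^ 2 = 1 ∨ ‖inner ℂ u v‖ ^ 2 = 1 / 3 := by
  obtain ⟨τ, hτ⟩ := exists_type hZX
  have := (hτ u huZ huX).2 v hvZ hvX
  by_cases h : τ v = τ u
  · rcases this.1 h with h | h <;> simp [h]
  · exact Or.inr (Or.inr (this.2 h))

/-- No three pairwise unbiased vectors are unbiased to both `Z` and `X`, as there are only two
types. -/
theorem not_three_equiangular {Z X : OrthonormalBasis (Fin 3) ℂ E} (hZX : MutuallyUnbiased X Z)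
    {u : Fin 3 → E} (hZ : ∀ i, VectorUnbiased Z (u i)) (hX : ∀ i, VectorUnbiased X (u i))
    (h01 : ‖inner ℂ (u 0) (u 1)‖ ^ 2 = 1 / 3) (h02 : ‖inner ℂ (u 0) (u 2)‖ ^ 2 = 1 / 3)
    (h12 : ‖inner ℂ (u 1) (u 2)‖ ^ 2 = 1 / 3) : False := by
  obtain ⟨τ, hτ⟩ := exists_type hZX
  have hne : ∀ i j, ‖inner ℂ (u i) (u j)‖ ^ 2 = 1 / 3 → τ (u j) ≠ τ (u i) := fun i j hij h => by
    rcases ((hτ _ (hZ i) (hX i)).2 _ (hZ j) (hX j)).1 h with h | h <;> rw [h] at hij <;>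
      norm_num at hij
  have hprim : ∀ i, τ (u i) ^ 2 + τ (u i) + 1 = 0 := fun i => (hτ _ (hZ i) (hX i)).1
  -- there are only two primitive cube roots of unity
  have h1 := (primitive_eq_or (hprim 0) (hprim 1)).resolve_left (hne 0 1 h01)
  have h2 := (primitive_eq_or (hprim 0) (hprim 2)).resolve_left (hne 0 2 h02)
  exact hne 1 2 h12 (h2.trans h1.symm)

/-- Two bases unbiased to both `Z` and `X` consist of the same rays, or some vector of one is
unbiased to the other. -/
theorem equal_rays_or_exists_unbiased {Z X Y Y' : OrthonormalBasis (Fin 3) ℂ E}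
    (hZX : MutuallyUnbiased X Z) (hYZ : ∀ k, VectorUnbiased Z (Y k))
    (hYX : ∀ k, VectorUnbiased X (Y k)) (hYZ' : ∀ k, VectorUnbiased Z (Y' k))
    (hYX' : ∀ k, VectorUnbiased X (Y' k)) :
    (∀ k, ∃ l, ‖inner ℂ (Y k) (Y' l)‖ ^ 2 = 1) ∨
      ∃ k, VectorUnbiased Y' (Y k) := by
  by_contra! hcon
  obtain ⟨⟨k, hk⟩, hno⟩ := hcon
  have hval := fun l => overlap_of_unbiased hZX (hYZ k) (hYX k) (hYZ' l) (hYX' l)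
  have hsum := Y'.sum_sq_norm_inner_left (Y k)
  rw [Y.norm_eq_one, Fin.sum_univ_three] at hsum
  apply hno k
  have h0 := (hval 0).imp_right (Or.resolve_left · (hk 0))
  have h1 := (hval 1).imp_right (Or.resolve_left · (hk 1))
  have h2 := (hval 2).imp_right (Or.resolve_left · (hk 2))
  intro l
  rw [norm_inner_symm]
  rcases h0 with h0 | h0 <;> rcases h1 with h1 | h1 <;> rcases h2 with h2 | h2 <;>
    rw [h0, h1, h2] at hsum <;> norm_num at hsum
  fin_cases l <;> simp [h0, h1, h2]

end Dim3

/-! ### Unit vectors and orthonormal families -/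

section UnitVectors
variable {E : Type*} [NormedAddCommGroup E] [InnerProductSpace ℂ E]

theorem eq_inner_smul_of_norm_inner {u v : E} (hu : ‖u‖ = 1) (hv : ‖v‖ = 1)
    (h : ‖inner ℂ u v‖ ^ 2 = 1) : v = inner ℂ u v • u := by
  have h1 : ‖inner ℂ u v‖ = ‖u‖ * ‖v‖ := by
    rw [hu, hv, mul_one]
    exact (pow_eq_one_iff_of_nonneg (norm_nonneg _) two_ne_zero).1 h
  have hu0 : u ≠ 0 := by rintro rfl; simp at hu
  have hv0 : v ≠ 0 := by rintro rfl; simp at hv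
  obtain ⟨r, -, hr⟩ := (norm_inner_eq_norm_iff hu0 hv0).1 h1
  rw [hr, inner_smul_right, inner_self_eq_norm_sq_to_K, hu]
  simp

theorem exists_orthonormalBasis_coe_eq {n : ℕ} (hn : Module.finrank ℂ E = n) (hn0 : n ≠ 0)
    {v : Fin n → E} (hv : Orthonormal ℂ v) : ∃ b : OrthonormalBasis (Fin n) ℂ E, ⇑b = v := by
  have : Nonempty (Fin n) := ⟨⟨0, Nat.pos_of_ne_zero hn0⟩⟩
  refine ⟨OrthonormalBasis.mk hv ?_, OrthonormalBasis.coe_mk _ _⟩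
  rw [hv.linearIndependent.span_eq_top_of_card_eq_finrank (by simp [hn])]

/-! ### Vectors unbiased to a pair of unbiased vectors of a qubit -/

theorem exists_orthonormalBasis_apply_zero_eq (hE : Module.finrank ℂ E = 2) {u : E}
    (hu : ‖u‖ = 1) : ∃ b : OrthonormalBasis (Fin 2) ℂ E, b 0 = u := by
  have : FiniteDimensional ℂ E := Module.finite_of_finrank_pos (by omega)
  obtain ⟨b, hb⟩ := Orthonormal.exists_orthonormalBasis_extension_of_card_eq (𝕜 := ℂ) (E := E)
    (ι := Fin 2) (by simp [hE]) (v := fun _ => u) (s := {0})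
    ⟨fun i => hu, fun i j hij => absurd (Subsingleton.elim i j) hij⟩
  exact ⟨b, hb 0 rfl⟩

theorem vectorUnbiased_of_apply_zero {b : OrthonormalBasis (Fin 2) ℂ E} {u : E} (hu : ‖u‖ = 1)
    (h : ‖inner ℂ (b 0) u‖ ^ 2 = 1 / 2) : VectorUnbiased b u := by
  have hsum := b.sum_sq_norm_inner_right u
  rw [Fin.sum_univ_two, hu, h] at hsum
  intro k
  fin_cases k
  · simpa using h
  · simp only [Fintype.card_fin, Fin.mk_one]
    push_cast
    linarith

theorem VectorUnbiased.normSq_eq_half {b : OrthonormalBasis (Fin 2) ℂ E} {u : E}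
    (h : VectorUnbiased b u) (i : Fin 2) : normSq (inner ℂ (b i) u) = 1 / 2 := by
  rw [normSq_eq_norm_sq, h i]; simp

theorem norm_inner_sq_eq_coord {b : OrthonormalBasis (Fin 2) ℂ E} {u v : E}
    (hu : VectorUnbiased b u) (hv : VectorUnbiased b v) :
    ‖inner ℂ u v‖ ^ 2 = 1 / 2 + 2 * (conj (inner ℂ (b 0) u * conj (inner ℂ (b 1) u)) *
      (inner ℂ (b 0) v * conj (inner ℂ (b 1) v))).re := by
  rw [← normSq_eq_norm_sq, ← b.sum_inner_mul_inner u v, Fin.sum_univ_two, normSq_add,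
    ← inner_conj_symm u (b 0), ← inner_conj_symm u (b 1)]
  simp only [map_mul, normSq_conj, hu.normSq_eq_half, hv.normSq_eq_half, conj_conj]
  ring_nf

/-- In `ℂ²` the vectors unbiased to `b` and to `c`, themselves unbiased, are parallel or orthogonal:
on the Bloch sphere, there is only one line orthogonal to two orthogonal ones. -/
theorem overlap_of_unbiased_two {b : OrthonormalBasis (Fin 2) ℂ E} {c u v : E}
    (hc : VectorUnbiased b c) (hu : VectorUnbiased b u) (hv : VectorUnbiased b v)
    (hcu : ‖inner ℂ c u‖ ^ 2 = 1 / 2) (hcv : ‖inner ℂ c v‖ ^ 2 = 1 / 2) :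
    ‖inner ℂ u v‖ ^ 2 = 0 ∨ ‖inner ℂ u v‖ ^ 2 = 1 := by
  have hn : ∀ w, VectorUnbiased b w →
      normSq (inner ℂ (b 0) w * conj (inner ℂ (b 1) w)) = 1 / 4 := fun w hw => by
    rw [map_mul, normSq_conj, hw.normSq_eq_half, hw.normSq_eq_half]; norm_num
  rw [norm_inner_sq_eq_coord hc hu] at hcu
  rw [norm_inner_sq_eq_coord hc hv] at hcv
  rw [norm_inner_sq_eq_coord hu hv]
  have h1 := hn c hc
  have h2 := hn u hu
  have h3 := hn v hv
  generalize inner ℂ (b 0) c * conj (inner ℂ (b 1) c) = p at *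
  generalize inner ℂ (b 0) u * conj (inner ℂ (b 1) u) = q at *
  generalize inner ℂ (b 0) v * conj (inner ℂ (b 1) v) = r at *
  have h4 : (conj p * q).re = 0 := by linarith
  have h5 : (conj p * r).re = 0 := by linarith
  have h6 : normSq (conj p * q) = 1 / 16 := by rw [map_mul, normSq_conj, h1, h2]; norm_num
  have h7 : normSq (conj p * r) = 1 / 16 := by rw [map_mul, normSq_conj, h1, h3]; norm_num
  have h8 : conj (conj p * q) * (conj p * r) = 1 / 4 * (conj q * r) := by
    have : p * conj p = 1 / 4 := by rw [mul_conj, h1]; norm_num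
    rw [← this, map_mul, conj_conj]; ring
  have h9 := congrArg re h8
  rw [normSq_apply, h4] at h6
  rw [normSq_apply, h5] at h7
  rw [mul_re, conj_re, conj_im, h4, h5] at h9
  have h10 : (1 / 4 * (conj q * r)).re = 1 / 4 * (conj q * r).re := by
    rw [show (1 / 4 : ℂ) = ((1 / 4 : ℝ) : ℂ) by push_cast; rfl, re_ofReal_mul]
  rw [h10] at h9
  have h11 : ((conj q * r).re - 1 / 4) * ((conj q * r).re + 1 / 4) = 0 := by
    have h : (conj q * r).re = 4 * ((conj p * q).im * (conj p * r).im) := by linarith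
    rw [h]
    linear_combination 16 * (conj p * q).im * (conj p * q).im * h7 + h6
  rcases mul_eq_zero.1 h11 with h | h
  · right; linarith
  · left; linarith

theorem eq_zero_of_re_mul_eq_zero {p q F : ℂ} (hp : p ≠ 0) (hq : q ≠ 0)
    (hpq : (conj p * q).re = 0) (h1 : (p * F).re = 0) (h2 : (q * F).re = 0) : F = 0 := by
  simp only [mul_re, conj_re, conj_im] at hpq h1 h2
  have hdet : (p.re * q.im - p.im * q.re) ^ 2 = normSq p * normSq q := by
    rw [normSq_apply, normSq_apply]
    linear_combination (-p.re * q.re - p.im * q.im) * hpq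
  have hdet0 : p.re * q.im - p.im * q.re ≠ 0 := by
    intro h
    rw [h] at hdet
    have := mul_ne_zero ((map_ne_zero normSq).2 hp) ((map_ne_zero normSq).2 hq)
    exact this (by rw [← hdet]; norm_num)
  apply Complex.ext
  · refine (mul_eq_zero.1 ?_).resolve_left hdet0
    linear_combination q.im * h1 - p.im * h2
  · refine (mul_eq_zero.1 ?_).resolve_left hdet0
    linear_combination q.re * h1 - p.re * h2

end UnitVectors

/-! ### The structure of mutually unbiased product bases -/

theorem norm_inner_tmul_sq {E F : Type*} [NormedAddCommGroup E] [InnerProductSpace ℂ E]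
    [NormedAddCommGroup F] [InnerProductSpace ℂ F] (a b : E) (A C : F) :
    ‖inner ℂ (a ⊗ₜ[ℂ] A) (b ⊗ₜ[ℂ] C)‖ ^ 2 = ‖inner ℂ a b‖ ^ 2 * ‖inner ℂ A C‖ ^ 2 := by
  rw [TensorProduct.inner_tmul, norm_mul, mul_pow]

theorem IsProductBasis.exists_unit {B : OrthonormalBasis (Fin 6) ℂ QubitQutrit}
    (hB : IsProductBasis B) : ∃ (a : Fin 6 → EuclideanSpace ℂ (Fin 2))
      (A : Fin 6 → EuclideanSpace ℂ (Fin 3)),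
      (∀ k, B k = a k ⊗ₜ[ℂ] A k) ∧ (∀ k, ‖a k‖ = 1) ∧ ∀ k, ‖A k‖ = 1 := by
  choose a A h using hB
  have hn : ∀ k, ‖a k‖ * ‖A k‖ = 1 := fun k => by
    rw [← TensorProduct.norm_tmul (𝕜 := ℂ), ← h, B.norm_eq_one]
  have ha : ∀ k, ‖a k‖ ≠ 0 := fun k h0 => by
    have := hn k
    rw [h0] at this
    norm_num at this
  refine ⟨fun k => (‖a k‖⁻¹ : ℂ) • a k, fun k => (‖a k‖ : ℂ) • A k, fun k => ?_, fun k => ?_,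
    fun k => ?_⟩
  · rw [TensorProduct.smul_tmul_smul, inv_mul_cancel₀ (by exact_mod_cast ha k), one_smul, h]
  · rw [norm_smul, norm_inv, norm_real, norm_norm, inv_mul_cancel₀ (ha k)]
  · rw [norm_smul, norm_real, norm_norm, hn]

section PartialTrace
variable {B : OrthonormalBasis (Fin 6) ℂ QubitQutrit} {a : Fin 6 → EuclideanSpace ℂ (Fin 2)}
  {A : Fin 6 → EuclideanSpace ℂ (Fin 3)}

/-- The partial trace over `ℂ²` of the identity of `ℂ² ⊗ ℂ³` is twice the identity. -/
theorem sum_norm_inner_right_factor (hB : ∀ k, B k = a k ⊗ₜ[ℂ] A k) (ha : ∀ k, ‖a k‖ = 1)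
    {C : EuclideanSpace ℂ (Fin 3)} (hC : ‖C‖ = 1) : ∑ k, ‖inner ℂ (A k) C‖ ^ 2 = 2 := by
  let e := EuclideanSpace.basisFun (Fin 2) ℂ
  calc ∑ k, ‖inner ℂ (A k) C‖ ^ 2 = ∑ k, ∑ i, ‖inner ℂ (B k) (e i ⊗ₜ[ℂ] C)‖ ^ 2 := by
        refine Finset.sum_congr rfl fun k _ => ?_
        simp only [hB, norm_inner_tmul_sq]
        rw [← Finset.sum_mul, e.sum_sq_norm_inner_left, ha]
        ring
    _ = ∑ i, ‖e i ⊗ₜ[ℂ] C‖ ^ 2 := by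
        rw [Finset.sum_comm]
        exact Finset.sum_congr rfl fun i _ => B.sum_sq_norm_inner_right _
    _ = 2 := by simp [TensorProduct.norm_tmul, hC, e.norm_eq_one]

/-- The partial trace over `ℂ³` of the identity of `ℂ² ⊗ ℂ³` is three times the identity. -/
theorem sum_norm_inner_left_factor (hB : ∀ k, B k = a k ⊗ₜ[ℂ] A k) (hA : ∀ k, ‖A k‖ = 1)
    {c : EuclideanSpace ℂ (Fin 2)} (hc : ‖c‖ = 1) : ∑ k, ‖inner ℂ (a k) c‖ ^ 2 = 3 := by
  let e := EuclideanSpace.basisFun (Fin 3) ℂ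
  calc ∑ k, ‖inner ℂ (a k) c‖ ^ 2 = ∑ k, ∑ i, ‖inner ℂ (B k) (c ⊗ₜ[ℂ] e i)‖ ^ 2 := by
        refine Finset.sum_congr rfl fun k _ => ?_
        simp only [hB, norm_inner_tmul_sq]
        rw [← Finset.mul_sum, e.sum_sq_norm_inner_left, hA]
        ring
    _ = ∑ i, ‖c ⊗ₜ[ℂ] e i‖ ^ 2 := by
        rw [Finset.sum_comm]
        exact Finset.sum_congr rfl fun i _ => B.sum_sq_norm_inner_right _
    _ = 3 := by simp [TensorProduct.norm_tmul, hc, e.norm_eq_one]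

/-- A product vector unbiased to a product basis is unbiased in the first factor. With
`p k = |⟪a k, c⟫|²` and `q k = |⟪A k, C⟫|²` one has `p k * q k = 1 / 6`, `∑ p = 3` and `∑ q = 2`, and
this is the equality case of the inequality between the harmonic and the arithmetic mean. -/
theorem norm_inner_left_factor_of_unbiased (hB : ∀ k, B k = a k ⊗ₜ[ℂ] A k) (ha : ∀ k, ‖a k‖ = 1)
    (hA : ∀ k, ‖A k‖ = 1) {c : EuclideanSpace ℂ (Fin 2)} {C : EuclideanSpace ℂ (Fin 3)}
    (hc : ‖c‖ = 1) (hC : ‖C‖ = 1) (h : VectorUnbiased B (c ⊗ₜ[ℂ] C)) (k : Fin 6) :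
    ‖inner ℂ (a k) c‖ ^ 2 = 1 / 2 := by
  have hpq : ∀ k, ‖inner ℂ (a k) c‖ ^ 2 * ‖inner ℂ (A k) C‖ ^ 2 = 1 / 6 := fun k => by
    rw [← norm_inner_tmul_sq, ← hB, h k]; simp
  have hp := sum_norm_inner_left_factor hB hA hc
  have hq := sum_norm_inner_right_factor hB ha hC
  set p := fun k => ‖inner ℂ (a k) c‖ ^ 2
  set q := fun k => ‖inner ℂ (A k) C‖ ^ 2
  have hsum : ∑ k, q k * (2 * p k - 1) ^ 2 = 0 := by
    -- expand, using `p k * q k = 1 / 6`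
    have : ∀ k, q k * (2 * p k - 1) ^ 2 = 2 / 3 * p k - 2 / 3 + q k := fun k => by
      linear_combination (4 * p k - 4) * hpq k
    simp only [this, Finset.sum_add_distrib, Finset.sum_sub_distrib, ← Finset.mul_sum]
    rw [hp, hq]
    norm_num
  have h0 := (Finset.sum_eq_zero_iff_of_nonneg (fun k _ =>
    mul_nonneg (sq_nonneg _) (sq_nonneg _))).1 hsum k (Finset.mem_univ k)
  have hq0 : q k ≠ 0 := fun h0 => by
    have : p k * q k = 1 / 6 := hpq k
    rw [h0] at this
    norm_num at this
  have := pow_eq_zero_iff two_ne_zero |>.1 ((mul_eq_zero.1 h0).resolve_left hq0)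
  change p k = 1 / 2
  linarith

end PartialTrace

/-- The product basis `B` is composed of an orthonormal basis `e` of `ℂ²` and, for each `e j`, an
orthonormal basis `D j` of `ℂ³`. Every `e j ⊗ D j i` is required to occur in `B` exactly, not just up
to a phase; by counting, these are all the elements of `B`. -/
def IsFibred (B : OrthonormalBasis (Fin 6) ℂ QubitQutrit)
    (e : OrthonormalBasis (Fin 2) ℂ (EuclideanSpace ℂ (Fin 2)))
    (D : Fin 2 → OrthonormalBasis (Fin 3) ℂ (EuclideanSpace ℂ (Fin 3))) : Prop :=
  ∀ j i, ∃ m, B m = e j ⊗ₜ[ℂ] D j i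

/-- If the first factors of a product basis are pairwise parallel or orthogonal, they lie on two
orthogonal rays, each of which carries three of the six basis vectors by the partial trace. -/
theorem exists_isFibred {B : OrthonormalBasis (Fin 6) ℂ QubitQutrit}
    {a : Fin 6 → EuclideanSpace ℂ (Fin 2)} {A : Fin 6 → EuclideanSpace ℂ (Fin 3)}
    (hB : ∀ k, B k = a k ⊗ₜ[ℂ] A k) (ha : ∀ k, ‖a k‖ = 1) (hA : ∀ k, ‖A k‖ = 1)
    (h : ∀ k l, ‖inner ℂ (a k) (a l)‖ ^ 2 = 0 ∨ ‖inner ℂ (a k) (a l)‖ ^ 2 = 1) :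
    ∃ e D, IsFibred B e D := by
  have hcard : ∀ l, (Finset.univ.filter fun k => ‖inner ℂ (a k) (a l)‖ ^ 2 = 1).card = 3 := by
    intro l
    have hs := sum_norm_inner_left_factor hB hA (ha l)
    have : ∀ k, ‖inner ℂ (a k) (a l)‖ ^ 2 = if ‖inner ℂ (a k) (a l)‖ ^ 2 = 1 then 1 else 0 := by
      intro k
      rcases h k l with h | h <;> simp [h]
    rw [Finset.sum_congr rfl fun k _ => this k, Finset.sum_boole] at hs
    exact_mod_cast hs
  obtain ⟨m, hm⟩ : ∃ m, ‖inner ℂ (a m) (a 0)‖ ^ 2 = 0 := by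
    by_contra! hne
    have := hcard 0
    rw [Finset.filter_true_of_mem fun k _ => (h k 0).resolve_left (hne k)] at this
    simp at this
  have hm0 : inner ℂ (a m) (a 0) = 0 := by simpa using hm
  let μ : Fin 2 → Fin 6 := ![0, m]
  have hμ : Orthonormal ℂ fun j => a (μ j) := by
    refine ⟨fun j => ha _, fun i j hij => ?_⟩
    fin_cases i <;> fin_cases j <;> simp [μ, hm0, inner_eq_zero_symm.1 hm0] at hij ⊢
  obtain ⟨e, he⟩ := exists_orthonormalBasis_coe_eq (by simp) two_ne_zero hμ
  have hfib : ∀ j : Fin 2, ∃ D : OrthonormalBasis (Fin 3) ℂ (EuclideanSpace ℂ (Fin 3)),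
      ∀ i, ∃ m, B m = e j ⊗ₜ[ℂ] D i := by
    intro j
    let κ := (Finset.univ.filter fun k => ‖inner ℂ (a k) (a (μ j))‖ ^ 2 = 1).orderEmbOfFin
      (hcard (μ j))
    have hκ : ∀ i, ‖inner ℂ (a (μ j)) (a (κ i))‖ ^ 2 = 1 := fun i => by
      rw [norm_inner_symm]
      exact (Finset.mem_filter.1 (Finset.orderEmbOfFin_mem _ (hcard (μ j)) i)).2
    have hBκ : ∀ i, B (κ i) = e j ⊗ₜ[ℂ] (inner ℂ (a (μ j)) (a (κ i)) • A (κ i)) := fun i => by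
      rw [← TensorProduct.smul_tmul, hB, he, ← eq_inner_smul_of_norm_inner (ha _) (ha _) (hκ i)]
    have hD : Orthonormal ℂ fun i => inner ℂ (a (μ j)) (a (κ i)) • A (κ i) := by
      rw [orthonormal_iff_ite]
      intro i i'
      have := orthonormal_iff_ite.1 B.orthonormal (κ i) (κ i')
      rw [hBκ, hBκ, TensorProduct.inner_tmul, inner_self_eq_norm_sq_to_K, e.norm_eq_one] at this
      simpa using this
    obtain ⟨D, hD'⟩ := exists_orthonormalBasis_coe_eq (by simp) three_ne_zero hD
    exact ⟨D, fun i => ⟨κ i, by rw [hD', hBκ]⟩⟩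
  choose D hD using hfib
  exact ⟨e, D, hD⟩

theorem MutuallyUnbiased.symm {ι E : Type*} [Fintype ι] [NormedAddCommGroup E]
    [InnerProductSpace ℂ E] {B B' : OrthonormalBasis ι ℂ E} (h : MutuallyUnbiased B B') :
    MutuallyUnbiased B' B := fun j k => by
  rw [norm_inner_symm]; exact h k j

/-- The first factors of `B₁` are unbiased to one first factor of `B₂` and to one of `B₃`, hence are
pairwise parallel or orthogonal. -/
theorem exists_isFibred_of_triple {B₁ B₂ B₃ : OrthonormalBasis (Fin 6) ℂ QubitQutrit}
    (hp₁ : IsProductBasis B₁) (hp₂ : IsProductBasis B₂) (hp₃ : IsProductBasis B₃)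
    (h₁₂ : MutuallyUnbiased B₁ B₂) (h₁₃ : MutuallyUnbiased B₁ B₃) (h₂₃ : MutuallyUnbiased B₂ B₃) :
    ∃ e D, IsFibred B₁ e D := by
  obtain ⟨a, A, hB, ha, hA⟩ := hp₁.exists_unit
  obtain ⟨b, B, hB', hb, hbB⟩ := hp₂.exists_unit
  obtain ⟨c, C, hC', hc, hcC⟩ := hp₃.exists_unit
  refine exists_isFibred hB ha hA fun k l => ?_
  have hba : ∀ k, ‖inner ℂ (b 0) (a k)‖ ^ 2 = 1 / 2 := fun k =>
    norm_inner_left_factor_of_unbiased hB' hb hbB (ha k) (hA k)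
      (by rw [← hB]; exact fun j => h₁₂ j k) 0
  have hca : ∀ k, ‖inner ℂ (c 0) (a k)‖ ^ 2 = 1 / 2 := fun k =>
    norm_inner_left_factor_of_unbiased hC' hc hcC (ha k) (hA k)
      (by rw [← hB]; exact fun j => h₁₃ j k) 0
  have hbc : ‖inner ℂ (b 0) (c 0)‖ ^ 2 = 1 / 2 :=
    norm_inner_left_factor_of_unbiased hB' hb hbB (hc 0) (hcC 0)
      (by rw [← hC']; exact fun j => h₂₃.symm j 0) 0
  obtain ⟨f, hf⟩ := exists_orthonormalBasis_apply_zero_eq (by simp) (hb 0)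
  rw [← hf] at hbc hba
  exact overlap_of_unbiased_two (vectorUnbiased_of_apply_zero (hc 0) hbc)
    (vectorUnbiased_of_apply_zero (ha k) (hba k)) (vectorUnbiased_of_apply_zero (ha l) (hba l))
    (hca k) (hca l)

theorem IsFibred.overlaps {B B' : OrthonormalBasis (Fin 6) ℂ QubitQutrit}
    {e e' : OrthonormalBasis (Fin 2) ℂ (EuclideanSpace ℂ (Fin 2))}
    {D D' : Fin 2 → OrthonormalBasis (Fin 3) ℂ (EuclideanSpace ℂ (Fin 3))}
    (h : IsFibred B e D) (h' : IsFibred B' e' D') (hBB : MutuallyUnbiased B B') (j j' : Fin 2) :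
    ‖inner ℂ (e' j') (e j)‖ ^ 2 = 1 / 2 ∧ MutuallyUnbiased (D j) (D' j') := by
  have hpq : ∀ i' i, ‖inner ℂ (e' j') (e j)‖ ^ 2 * ‖inner ℂ (D' j' i') (D j i)‖ ^ 2 = 1 / 6 := by
    intro i' i
    obtain ⟨m, hm⟩ := h j i
    obtain ⟨m', hm'⟩ := h' j' i'
    rw [← norm_inner_tmul_sq, ← hm, ← hm', hBB]
    simp
  have hhalf : ‖inner ℂ (e' j') (e j)‖ ^ 2 = 1 / 2 := by
    have hs := (D' j').sum_sq_norm_inner_right (D j 0)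
    rw [(D j).norm_eq_one] at hs
    have := Finset.sum_congr rfl fun i' (_ : i' ∈ Finset.univ) => hpq i' 0
    rw [← Finset.mul_sum, hs] at this
    norm_num at this ⊢
    exact this
  refine ⟨hhalf, fun i' i => ?_⟩
  have := hpq i' i
  rw [hhalf] at this
  simp only [Fintype.card_fin]
  push_cast
  linarith

/-! ### Contraction of a bipartite vector -/

/-- The contraction `(⟨a| ⊗ 1) ψ`, conjugate-linear in `a`, characterized by
`inner_partialInner`. -/
noncomputable def partialInner (ψ : QubitQutrit) (a : EuclideanSpace ℂ (Fin 2)) :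
    EuclideanSpace ℂ (Fin 3) :=
  ∑ i, inner ℂ (a ⊗ₜ[ℂ] EuclideanSpace.basisFun (Fin 3) ℂ i) ψ •
    EuclideanSpace.basisFun (Fin 3) ℂ i

theorem inner_tmul_smul_left (ψ : QubitQutrit) (a : EuclideanSpace ℂ (Fin 2))
    (A : EuclideanSpace ℂ (Fin 3)) (c : ℂ) :
    inner ℂ (a ⊗ₜ[ℂ] (c • A)) ψ = conj c * inner ℂ (a ⊗ₜ[ℂ] A) ψ := by
  rw [TensorProduct.tmul_smul]
  exact inner_smul_left (𝕜 := ℂ) (a ⊗ₜ[ℂ] A) ψ c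

theorem inner_partialInner (ψ : QubitQutrit) (a : EuclideanSpace ℂ (Fin 2))
    (A : EuclideanSpace ℂ (Fin 3)) : inner ℂ A (partialInner ψ a) = inner ℂ (a ⊗ₜ[ℂ] A) ψ := by
  conv_rhs => rw [← (EuclideanSpace.basisFun (Fin 3) ℂ).sum_repr' A]
  simp only [partialInner, inner_sum, inner_smul_right, TensorProduct.tmul_sum, sum_inner,
    inner_tmul_smul_left, inner_conj_symm]
  exact Finset.sum_congr rfl fun i _ => mul_comm _ _

theorem partialInner_eq_add (ψ : QubitQutrit)
    (e : OrthonormalBasis (Fin 2) ℂ (EuclideanSpace ℂ (Fin 2))) (a : EuclideanSpace ℂ (Fin 2)) :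
    partialInner ψ a = conj (inner ℂ (e 0) a) • partialInner ψ (e 0) +
      conj (inner ℂ (e 1) a) • partialInner ψ (e 1) := by
  refine ext_inner_left ℂ fun A => ?_
  rw [inner_add_right, inner_smul_right, inner_smul_right, inner_partialInner, inner_partialInner,
    inner_partialInner]
  conv_lhs => rw [← e.sum_repr' a, Fin.sum_univ_two]
  rw [TensorProduct.add_tmul, TensorProduct.smul_tmul, TensorProduct.smul_tmul,
    inner_add_left, inner_tmul_smul_left, inner_tmul_smul_left]

section Fibred
variable {B : OrthonormalBasis (Fin 6) ℂ QubitQutrit}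
  {e : OrthonormalBasis (Fin 2) ℂ (EuclideanSpace ℂ (Fin 2))}
  {D : Fin 2 → OrthonormalBasis (Fin 3) ℂ (EuclideanSpace ℂ (Fin 3))} {ψ : QubitQutrit}

theorem IsFibred.norm_inner_partialInner (h : IsFibred B e D) (hψ : VectorUnbiased B ψ)
    (j : Fin 2) (i : Fin 3) : ‖inner ℂ (D j i) (partialInner ψ (e j))‖ ^ 2 = 1 / 6 := by
  obtain ⟨m, hm⟩ := h j i
  rw [inner_partialInner, ← hm, hψ m]
  simp

theorem IsFibred.norm_partialInner (h : IsFibred B e D) (hψ : VectorUnbiased B ψ) (j : Fin 2) :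
    ‖partialInner ψ (e j)‖ ^ 2 = 1 / 2 := by
  rw [← (D j).sum_sq_norm_inner_right]
  simp [h.norm_inner_partialInner hψ]
  norm_num

end Fibred

/-- A vector whose contractions with the elements of three mutually unbiased pairs of `ℂ²` all have
square norm `1 / 2` is maximally entangled: up to the factor `1 / 2`, contraction is an
anti-isometry. It suffices to know this for a basis `e` and one vector `b`, `c` from each of the other
two pairs. The overlap `F` of the contractions with `e 0` and `e 1` satisfies `Re (p F) = 0` and
`Re (q F) = 0` for two numbers `p`, `q` that are linearly independent over the reals. -/
theorem inner_partialInner_partialInner {ψ : QubitQutrit}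
    {e : OrthonormalBasis (Fin 2) ℂ (EuclideanSpace ℂ (Fin 2))} {b c : EuclideanSpace ℂ (Fin 2)}
    (he : ∀ j, ‖partialInner ψ (e j)‖ ^ 2 = 1 / 2) (hb : VectorUnbiased e b)
    (hc : VectorUnbiased e c) (hbc : ‖inner ℂ b c‖ ^ 2 = 1 / 2)
    (hb' : ‖partialInner ψ b‖ ^ 2 = 1 / 2) (hc' : ‖partialInner ψ c‖ ^ 2 = 1 / 2)
    (x y : EuclideanSpace ℂ (Fin 2)) :
    inner ℂ (partialInner ψ x) (partialInner ψ y) = 1 / 2 * inner ℂ y x := by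
  have hre : ∀ u, VectorUnbiased e u → ‖partialInner ψ u‖ ^ 2 = 1 / 2 →
      (inner ℂ (e 0) u * conj (inner ℂ (e 1) u) *
        inner ℂ (partialInner ψ (e 0)) (partialInner ψ (e 1))).re = 0 := by
    intro u hu hu'
    rw [partialInner_eq_add ψ e u, @norm_add_sq ℂ, norm_smul, norm_smul, mul_pow, mul_pow,
      RCLike.norm_conj, RCLike.norm_conj, hu, hu, he, he, inner_smul_left, inner_smul_right,
      conj_conj, ← mul_assoc] at hu'
    simp at hu'
    simp
    linarith
  have hne : ∀ u, VectorUnbiased e u → inner ℂ (e 0) u * conj (inner ℂ (e 1) u) ≠ 0 := by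
    intro u hu
    rw [← map_ne_zero normSq, map_mul, normSq_conj, hu.normSq_eq_half, hu.normSq_eq_half]
    norm_num
  have h0 : inner ℂ (partialInner ψ (e 0)) (partialInner ψ (e 1)) = 0 := by
    refine eq_zero_of_re_mul_eq_zero (hne b hb) (hne c hc) ?_ (hre b hb hb') (hre c hc hc')
    rw [norm_inner_sq_eq_coord hb hc] at hbc
    linarith
  have h0' := inner_eq_zero_symm.1 h0
  have hee : ∀ j, inner ℂ (partialInner ψ (e j)) (partialInner ψ (e j)) = 1 / 2 := fun j => by
    rw [inner_self_eq_norm_sq_to_K]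
    have := congrArg (fun t : ℝ => (t : ℂ)) (he j)
    push_cast at this
    exact this
  rw [partialInner_eq_add ψ e x, partialInner_eq_add ψ e y, ← e.sum_inner_mul_inner y x,
    Fin.sum_univ_two]
  simp only [inner_add_left, inner_add_right, inner_smul_left, inner_smul_right, h0, h0', hee,
    inner_conj_symm]
  ring

theorem exists_unit_orthogonal (ψ : QubitQutrit) :
    ∃ χ : EuclideanSpace ℂ (Fin 3), ‖χ‖ = 1 ∧ ∀ x, inner ℂ χ (partialInner ψ x) = 0 := by
  let e := EuclideanSpace.basisFun (Fin 2) ℂ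
  let S := Submodule.span ℂ (Set.range fun j => partialInner ψ (e j))
  have hS : Sᗮ ≠ ⊥ := by
    rw [Ne, Submodule.orthogonal_eq_bot_iff]
    intro htop
    have h1 := finrank_range_le_card (R := ℂ) fun j => partialInner ψ (e j)
    rw [Set.finrank, show Submodule.span ℂ (Set.range fun j => partialInner ψ (e j)) = ⊤ from htop,
      finrank_top] at h1
    simp at h1
  obtain ⟨w, hw, hw0⟩ := Submodule.exists_mem_ne_zero_of_ne_bot hS
  have hwe : ∀ j, inner ℂ w (partialInner ψ (e j)) = 0 := fun j =>
    (Submodule.mem_orthogonal' S w).1 hw _ (Submodule.subset_span ⟨j, rfl⟩)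
  refine ⟨((‖w‖⁻¹ : ℝ) : ℂ) • w, ?_, fun x => ?_⟩
  · rw [norm_smul, norm_real, norm_inv, norm_norm, inv_mul_cancel₀ (norm_ne_zero_iff.2 hw0)]
  · rw [partialInner_eq_add ψ e x, inner_smul_left, inner_add_right, inner_smul_right,
      inner_smul_right, hwe, hwe]
    simp

/-- Parseval's identity in the orthonormal basis that consists of the two contractions of `ψ`,
multiplied by `√2`, and of `χ`. -/
theorem two_mul_sum_add_norm_inner {ψ : QubitQutrit} {χ : EuclideanSpace ℂ (Fin 3)}
    (hψ : ∀ x y, inner ℂ (partialInner ψ x) (partialInner ψ y) = 1 / 2 * inner ℂ y x)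
    (hχ : ‖χ‖ = 1) (hχψ : ∀ x, inner ℂ χ (partialInner ψ x) = 0)
    (e : OrthonormalBasis (Fin 2) ℂ (EuclideanSpace ℂ (Fin 2))) (A : EuclideanSpace ℂ (Fin 3)) :
    2 * ‖inner ℂ A (partialInner ψ (e 0))‖ ^ 2 + 2 * ‖inner ℂ A (partialInner ψ (e 1))‖ ^ 2 +
      ‖inner ℂ A χ‖ ^ 2 = ‖A‖ ^ 2 := by
  have h2 : ((√2 : ℝ) : ℂ) * ((√2 : ℝ) : ℂ) = 2 := by
    rw [← ofReal_mul, Real.mul_self_sqrt zero_le_two]; rfl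
  have h01 : inner ℂ (e 0) (e 1) = 0 := e.orthonormal.2 (by decide)
  have h10 : inner ℂ (e 1) (e 0) = 0 := e.orthonormal.2 (by decide)
  have hee : ∀ j, inner ℂ (e j) (e j) = 1 := fun j => by
    rw [inner_self_eq_norm_sq_to_K, e.norm_eq_one]; simp
  have hon : Orthonormal ℂ ![((√2 : ℝ) : ℂ) • partialInner ψ (e 0),
      ((√2 : ℝ) : ℂ) • partialInner ψ (e 1), χ] := by
    have h3 : ((√2 : ℝ) : ℂ) * (((√2 : ℝ) : ℂ) * 2⁻¹) = 1 := by
      rw [← mul_assoc, h2]; norm_num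
    have hχχ : inner ℂ χ χ = 1 := by rw [inner_self_eq_norm_sq_to_K, hχ]; simp
    rw [orthonormal_iff_ite]
    intro i j
    fin_cases i <;> fin_cases j <;>
      simp [inner_smul_left, inner_smul_right, hψ, h01, h10, hee, hχψ, hχχ,
        inner_eq_zero_symm.1 (hχψ _), h3, -coe_smul, -inner_self_eq_norm_sq_to_K]
  obtain ⟨V, hV⟩ := exists_orthonormalBasis_coe_eq (by simp) three_ne_zero hon
  have hs := V.sum_sq_norm_inner_left A
  rw [hV, Fin.sum_univ_three] at hs
  simp only [Matrix.cons_val, inner_smul_right, norm_mul, mul_pow, norm_real, Real.norm_eq_abs,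
    sq_abs, Real.sq_sqrt zero_le_two] at hs
  exact hs

/-! ### Three mutually unbiased product bases -/

/-- The orthonormal bases `D 0` and `D 1` consist of the same rays. -/
def SameRays (D : Fin 2 → OrthonormalBasis (Fin 3) ℂ (EuclideanSpace ℂ (Fin 3))) : Prop :=
  ∀ k, ∃ l, ‖inner ℂ (D 0 k) (D 1 l)‖ ^ 2 = 1

/-- Where `D 0` and `D 1` agree, both contractions of `ψ` are unbiased to `D 0`, hence so is the unit
vector `χ` orthogonal to them. -/
theorem IsFibred.vectorUnbiased_of_sameRays {B : OrthonormalBasis (Fin 6) ℂ QubitQutrit}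
    {e : OrthonormalBasis (Fin 2) ℂ (EuclideanSpace ℂ (Fin 2))}
    {D : Fin 2 → OrthonormalBasis (Fin 3) ℂ (EuclideanSpace ℂ (Fin 3))} {ψ : QubitQutrit}
    {χ : EuclideanSpace ℂ (Fin 3)} (h : IsFibred B e D) (hψB : VectorUnbiased B ψ)
    (hψ : ∀ x y, inner ℂ (partialInner ψ x) (partialInner ψ y) = 1 / 2 * inner ℂ y x)
    (hχ : ‖χ‖ = 1) (hχψ : ∀ x, inner ℂ χ (partialInner ψ x) = 0) (hD : SameRays D) :
    VectorUnbiased (D 0) χ := by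
  intro k
  obtain ⟨l, hl⟩ := hD k
  have h0 := h.norm_inner_partialInner hψB 0 k
  have h1 : ‖inner ℂ (D 0 k) (partialInner ψ (e 1))‖ ^ 2 = 1 / 6 := by
    have := h.norm_inner_partialInner hψB 1 l
    rwa [eq_inner_smul_of_norm_inner ((D 0).norm_eq_one k) ((D 1).norm_eq_one l) hl,
      inner_smul_left, norm_mul, mul_pow, RCLike.norm_conj, hl, one_mul] at this
  have hs := two_mul_sum_add_norm_inner hψ hχ hχψ e (D 0 k)
  rw [h0, h1, (D 0).norm_eq_one] at hs
  simp only [Fintype.card_fin]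
  push_cast
  linarith

/-- Among three mutually unbiased pairs of bases of `ℂ³`, at most one has two different members:
otherwise there would be more mutually unbiased bases than `not_three_equiangular` permits. -/
theorem sameRays_or_sameRays
    {D D' D'' : Fin 2 → OrthonormalBasis (Fin 3) ℂ (EuclideanSpace ℂ (Fin 3))}
    (h : ∀ i j, MutuallyUnbiased (D i) (D' j)) (h' : ∀ i j, MutuallyUnbiased (D i) (D'' j))
    (h'' : ∀ i j, MutuallyUnbiased (D' i) (D'' j)) : SameRays D ∨ SameRays D' := by
  rcases equal_rays_or_exists_unbiased (Z := D' 0) (X := D'' 0) (Y := D 0) (Y' := D 1)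
    (h'' 0 0).symm (fun k i => h 0 0 i k) (fun k i => h' 0 0 i k) (fun k i => h 1 0 i k)
    (fun k i => h' 1 0 i k) with hD | ⟨k, hk⟩
  · exact Or.inl hD
  rcases equal_rays_or_exists_unbiased (Z := D 0) (X := D'' 0) (Y := D' 0) (Y' := D' 1)
    (h' 0 0).symm (fun k i => (h 0 0).symm i k) (fun k i => h'' 0 0 i k)
    (fun k i => (h 0 1).symm i k) (fun k i => h'' 1 0 i k) with hD | ⟨l, hl⟩
  · exact Or.inr hD
  refine (not_three_equiangular (Z := D 1) (X := D'' 0) (h' 1 0).symm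
    (u := ![D 0 k, D' 0 l, D' 1 0]) (fun i => ?_) (fun i => ?_) ?_ ?_ ?_).elim
  · fin_cases i
    · exact hk
    · exact fun j => (h 1 0).symm j l
    · exact fun j => (h 1 1).symm j 0
  · fin_cases i
    · exact fun j => h' 0 0 j k
    · exact fun j => h'' 0 0 j l
    · exact fun j => h'' 1 0 j 0
  · simpa using (h 0 0).symm k l
  · simpa using (h 0 1).symm k 0
  · simpa [norm_inner_symm] using hl 0

theorem VectorUnbiased.smul_partialInner {B : OrthonormalBasis (Fin 6) ℂ QubitQutrit}
    {e : OrthonormalBasis (Fin 2) ℂ (EuclideanSpace ℂ (Fin 2))}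
    {D : Fin 2 → OrthonormalBasis (Fin 3) ℂ (EuclideanSpace ℂ (Fin 3))} {ψ : QubitQutrit}
    (hψ : VectorUnbiased B ψ) (h : IsFibred B e D) :
    VectorUnbiased (D 0) (((√2 : ℝ) : ℂ) • partialInner ψ (e 0)) := by
  intro k
  rw [inner_smul_right, norm_mul, mul_pow, h.norm_inner_partialInner hψ, norm_real,
    Real.norm_eq_abs, sq_abs, Real.sq_sqrt zero_le_two, Fintype.card_fin]
  norm_num

/-- For two of the bases, take the contraction of `ψ` with `e 0` and with `e' 0`. Both are orthogonal
to `χ`, so each is unbiased to `D 0` and `D' 0`; yet, once normalized, they have the squared overlap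
`1 / 2` of `e 0` and `e' 0`, which is not among the values `0`, `1 / 3`, `1` of `overlap_of_unbiased`. -/
theorem not_sameRays_both {B B' B'' : OrthonormalBasis (Fin 6) ℂ QubitQutrit}
    {e e' e'' : OrthonormalBasis (Fin 2) ℂ (EuclideanSpace ℂ (Fin 2))}
    {D D' D'' : Fin 2 → OrthonormalBasis (Fin 3) ℂ (EuclideanSpace ℂ (Fin 3))} {ψ : QubitQutrit}
    (h : IsFibred B e D) (h' : IsFibred B' e' D') (h'' : IsFibred B'' e'' D'')
    (hBB' : MutuallyUnbiased B B') (hBB'' : MutuallyUnbiased B B'')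
    (hBB : MutuallyUnbiased B' B'') (hψ : VectorUnbiased B ψ) (hψ' : VectorUnbiased B' ψ)
    (hψ'' : VectorUnbiased B'' ψ) (hD : SameRays D) (hD' : SameRays D') : False := by
  have hent := inner_partialInner_partialInner (b := e' 0) (c := e'' 0)
    (h.norm_partialInner hψ)
    (vectorUnbiased_of_apply_zero (e'.norm_eq_one 0) (h'.overlaps h hBB'.symm 0 0).1)
    (vectorUnbiased_of_apply_zero (e''.norm_eq_one 0) (h''.overlaps h hBB''.symm 0 0).1)
    (h''.overlaps h' hBB.symm 0 0).1
    (h'.norm_partialInner hψ' 0) (h''.norm_partialInner hψ'' 0)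
  obtain ⟨χ, hχ, hχψ⟩ := exists_unit_orthogonal ψ
  have hχD := h.vectorUnbiased_of_sameRays hψ hent hχ hχψ hD
  have hχD' := h'.vectorUnbiased_of_sameRays hψ' hent hχ hχψ hD'
  have hMU := (h.overlaps h' hBB' 0 0).2
  have hχψ' : ∀ x, inner ℂ χ (((√2 : ℝ) : ℂ) • partialInner ψ x) = 0 := fun x => by
    rw [inner_smul_right, hχψ, mul_zero]
  have hv := hψ.smul_partialInner h
  have hv' := hψ'.smul_partialInner h'
  have key := overlap_of_unbiased hMU.symm hv (hχD.of_orthogonal hMU.symm hχD' (hχψ' _) hv)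
    (hχD'.of_orthogonal hMU hχD (hχψ' _) hv') hv'
  have hhalf : ‖inner ℂ (((√2 : ℝ) : ℂ) • partialInner ψ (e 0))
      (((√2 : ℝ) : ℂ) • partialInner ψ (e' 0))‖ ^ 2 = 1 / 2 := by
    rw [inner_smul_left, inner_smul_right, hent, norm_mul, norm_mul, norm_mul, RCLike.norm_conj,
      norm_real, Real.norm_eq_abs, abs_of_nonneg (Real.sqrt_nonneg 2), ← mul_assoc,
      Real.mul_self_sqrt zero_le_two, ← mul_assoc, mul_pow, (h.overlaps h' hBB' 0 0).1]
    norm_num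
  rw [hhalf] at key
  norm_num at key

theorem theorem1 (B₁ B₂ B₃ : OrthonormalBasis (Fin 6) ℂ QubitQutrit)
    (hp₁ : IsProductBasis B₁) (hp₂ : IsProductBasis B₂) (hp₃ : IsProductBasis B₃)
    (h₁₂ : MutuallyUnbiased B₁ B₂) (h₁₃ : MutuallyUnbiased B₁ B₃) (h₂₃ : MutuallyUnbiased B₂ B₃) :
    ¬ ∃ ψ : QubitQutrit, VectorUnbiased B₁ ψ ∧ VectorUnbiased B₂ ψ ∧ VectorUnbiased B₃ ψ := by
  rintro ⟨ψ, hψ₁, hψ₂, hψ₃⟩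
  obtain ⟨e₁, D₁, f₁⟩ := exists_isFibred_of_triple hp₁ hp₂ hp₃ h₁₂ h₁₃ h₂₃
  obtain ⟨e₂, D₂, f₂⟩ := exists_isFibred_of_triple hp₂ hp₁ hp₃ h₁₂.symm h₂₃ h₁₃
  obtain ⟨e₃, D₃, f₃⟩ := exists_isFibred_of_triple hp₃ hp₁ hp₂ h₁₃.symm h₂₃.symm h₁₂
  have m₁₂ := fun i j => (f₁.overlaps f₂ h₁₂ i j).2
  have m₁₃ := fun i j => (f₁.overlaps f₃ h₁₃ i j).2
  have m₂₃ := fun i j => (f₂.overlaps f₃ h₂₃ i j).2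
  have s₁₂ := sameRays_or_sameRays m₁₂ m₁₃ m₂₃
  have s₁₃ := sameRays_or_sameRays m₁₃ m₁₂ fun i j => (m₂₃ j i).symm
  have s₂₃ := sameRays_or_sameRays m₂₃ (fun i j => (m₁₂ j i).symm) fun i j => (m₁₃ j i).symm
  have n₁₂ := not_sameRays_both f₁ f₂ f₃ h₁₂ h₁₃ h₂₃ hψ₁ hψ₂ hψ₃
  have n₁₃ := not_sameRays_both f₁ f₃ f₂ h₁₃ h₁₂ h₂₃.symm hψ₁ hψ₃ hψ₂
  have n₂₃ := not_sameRays_both f₂ f₃ f₁ h₂₃ h₁₂.symm h₁₃.symm hψ₂ hψ₃ hψ₁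
  tauto
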